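/- Let $R$ be a commutative Noetherian local ring with maximal ideal $\mathfrak{m}$ which is complete in the $\mathfrak{m}$-adic topology, and let $\Lambda$ be an (associative, unital, not necessarily commutative) $R$-algebra which is finitely generated and free as an $R$-module. Put $\overline{\Lambda} := \Lambda/\mathfrak{m}\Lambda$. Modules are right modules, $\mathcal{D}(A)$ denotes the derived category of all modules over a ring $A$, and a complex is perfect if it is isomorphic in $\mathcal{D}(A)$ to a bounded complex of finitely generated projective $A$-modules. Let $T$ be a pretilting complex of $\Lambda$, that is, a perfect complex of $\Lambda$ such that $\operatorname{Hom}_{\mathcal{D}(\Lambda)}(T,T[i])=0$ for every integer $i\neq 0$, and let $\overline{T} := T\otimes^{\mathbb{L}}_{\Lambda}\overline{\Lambda}$. Then the endomorphism ring $\operatorname{End}_{\mathcal{D}(\Lambda)}(T)$ is free as an $R$-module if and only if $$\operatorname{Hom}_{\mathcal{D}(\overline{\Lambda})}(\overline{T},\overline{T}[-1])=0.$$ -/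

import Mathlib

open CategoryTheory

open scoped TensorProduct ModuleCat.Algebra

universe w w' v

/-- The (abelian) category of right modules over a ring `A`, realised as the category of left modules
over the opposite ring. -/
abbrev RightModuleCat (A : Type v) [Ring A] := ModuleCat.{v} Aᵐᵒᵖ

noncomputable section

namespace BaseChange

section

variable {A B : Type v} [Ring A] [Ring B] (f : A →+* B)

/-- For a left `A`-module `M`, the `B`-submodule of `B ⊗[ℤ] M` generated by the elements
`b * f a ⊗ m - b ⊗ a • m`. -/
def relations (M : Type v) [AddCommGroup M] [Module A M] : Submodule B (B ⊗[ℤ] M) :=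
  Submodule.span B
    {x | ∃ (b : B) (a : A) (m : M), x = (b * f a) ⊗ₜ[ℤ] m - b ⊗ₜ[ℤ] (a • m)}

/-- The tensor product `B ⊗_A M` of `B`, viewed as a `B`-`A`-bimodule via `f : A → B`, with a left
`A`-module `M`, as a left `B`-module. (The rings are not assumed to be commutative.) -/
abbrev Tensor (M : Type v) [AddCommGroup M] [Module A M] : Type v :=
  (B ⊗[ℤ] M) ⧸ relations f M

/-- The `B`-linear map `id ⊗ g : B ⊗[ℤ] M → B ⊗[ℤ] N`. -/
def preMap {M N : Type v} [AddCommGroup M] [AddCommGroup N] [Module A M] [Module A N]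
    (g : M →ₗ[A] N) : (B ⊗[ℤ] M) →ₗ[B] (B ⊗[ℤ] N) :=
  TensorProduct.AlgebraTensorModule.map LinearMap.id g.toAddMonoidHom.toIntLinearMap

@[simp]
lemma preMap_tmul {M N : Type v} [AddCommGroup M] [AddCommGroup N] [Module A M] [Module A N]
    (g : M →ₗ[A] N) (b : B) (m : M) : preMap g (b ⊗ₜ[ℤ] m) = b ⊗ₜ[ℤ] g m := rfl

lemma relations_le_comap {M N : Type v} [AddCommGroup M] [AddCommGroup N] [Module A M]
    [Module A N] (g : M →ₗ[A] N) :
    relations f M ≤ (relations f N).comap (preMap g) := by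
  refine Submodule.span_le.2 ?_
  rintro _ ⟨b, a, m, rfl⟩
  refine Submodule.subset_span ⟨b, a, g m, ?_⟩
  simp

/-- The `B`-linear map `id ⊗ g : B ⊗_A M → B ⊗_A N`. -/
def map {M N : Type v} [AddCommGroup M] [AddCommGroup N] [Module A M] [Module A N]
    (g : M →ₗ[A] N) : Tensor f M →ₗ[B] Tensor f N :=
  Submodule.mapQ _ _ (preMap g) (relations_le_comap f g)

@[simp]
lemma map_mk_tmul {M N : Type v} [AddCommGroup M] [AddCommGroup N] [Module A M] [Module A N]
    (g : M →ₗ[A] N) (b : B) (m : M) :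
    map f g ((relations f M).mkQ (b ⊗ₜ[ℤ] m)) = (relations f N).mkQ (b ⊗ₜ[ℤ] g m) := rfl

lemma linearMap_ext {M N : Type v} [AddCommGroup M] [AddCommGroup N] [Module A M] [Module B N]
    {g h : Tensor f M →ₗ[B] N}
    (H : ∀ (b : B) (m : M), g ((relations f M).mkQ (b ⊗ₜ[ℤ] m)) =
      h ((relations f M).mkQ (b ⊗ₜ[ℤ] m))) : g = h := by
  refine LinearMap.ext fun x ↦ ?_
  obtain ⟨y, rfl⟩ := (relations f M).mkQ_surjective x
  induction y using TensorProduct.induction_on with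
  | zero => simp only [_root_.map_zero]
  | tmul b m => exact H b m
  | add y z hy hz => simp only [_root_.map_add, hy, hz]

/-- The base change functor `B ⊗_A -` from left `A`-modules to left `B`-modules. -/
def functor : ModuleCat.{v} A ⥤ ModuleCat.{v} B where
  obj M := ModuleCat.of B (Tensor f M)
  map g := ModuleCat.ofHom (map f g.hom)
  map_id M := by
    ext1
    exact linearMap_ext f fun _ _ ↦ rfl
  map_comp g h := by
    ext1
    exact linearMap_ext f fun _ _ ↦ rfl

instance : (functor f).Additive where
  map_add {M N g h} := by
    ext1
    refine linearMap_ext f fun b m ↦ ?_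
    change (relations f N).mkQ (b ⊗ₜ[ℤ] (g.hom m + h.hom m)) =
      (relations f N).mkQ (b ⊗ₜ[ℤ] g.hom m) + (relations f N).mkQ (b ⊗ₜ[ℤ] h.hom m)
    rw [TensorProduct.tmul_add, _root_.map_add]

end

end BaseChange

section

variable {A : Type v} [Ring A] [HasDerivedCategory.{w} (ModuleCat.{v} A)]

/-- An object of the derived category is a perfect complex if it is isomorphic to a bounded complex
of finitely generated projective modules. -/
def IsPerfectComplex (T : DerivedCategory (ModuleCat.{v} A)) : Prop :=
  ∃ (P : CochainComplex (ModuleCat.{v} A) ℤ) (a b : ℤ),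
    P.IsStrictlyGE a ∧ P.IsStrictlyLE b ∧
    (∀ n, Projective (P.X n)) ∧ (∀ n, Module.Finite A (P.X n)) ∧
    Nonempty (DerivedCategory.Q.obj P ≅ T)

/-- A pretilting complex is a perfect complex `T` such that `Hom(T, T[i]) = 0` in the derived
category for every integer `i ≠ 0`. -/
structure IsPretiltingComplex (T : DerivedCategory (ModuleCat.{v} A)) : Prop where
  isPerfectComplex : IsPerfectComplex T
  hom_shift_eq_zero (i : ℤ) (hi : i ≠ 0) (φ : T ⟶ T⟦i⟧) : φ = 0

end

section

variable {A B : Type v} [Ring A] [Ring B] (f : A →+* B)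
  [HasDerivedCategory.{w} (ModuleCat.{v} A)] [HasDerivedCategory.{w'} (ModuleCat.{v} B)]

/-- `X` is (a model of) the derived tensor product `B ⊗^L_A T`: it is isomorphic to the complex
`B ⊗_A P` for some projective resolution `P` of `T`, that is, a bounded above complex `P` of
projective `A`-modules which is isomorphic to `T` in the derived category. -/
def IsDerivedBaseChange (T : DerivedCategory (ModuleCat.{v} A))
    (X : DerivedCategory (ModuleCat.{v} B)) : Prop :=
  ∃ (P : CochainComplex (ModuleCat.{v} A) ℤ) (b : ℤ),
    P.IsStrictlyLE b ∧ (∀ n, Projective (P.X n)) ∧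
    Nonempty (DerivedCategory.Q.obj P ≅ T) ∧
    Nonempty (DerivedCategory.Q.obj
      (((BaseChange.functor f).mapHomologicalComplex (ComplexShape.up ℤ)).obj P) ≅ X)

/-- The derived tensor product of a perfect complex exists. -/
lemma IsPerfectComplex.exists_isDerivedBaseChange {T : DerivedCategory (ModuleCat.{v} A)}
    (hT : IsPerfectComplex T) :
    ∃ X : DerivedCategory (ModuleCat.{v} B), IsDerivedBaseChange f T X := by
  obtain ⟨P, a, b, -, hb, hP, -, e⟩ := hT
  exact ⟨_, P, b, hb, hP, e, ⟨Iso.refl _⟩⟩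

/-- The derived tensor product is unique up to isomorphism. -/
lemma IsDerivedBaseChange.nonempty_iso {T : DerivedCategory (ModuleCat.{v} A)}
    {X Y : DerivedCategory (ModuleCat.{v} B)}
    (hX : IsDerivedBaseChange f T X) (hY : IsDerivedBaseChange f T Y) : Nonempty (X ≅ Y) := by
  obtain ⟨P, b, _, _, ⟨e⟩, ⟨eX⟩⟩ := hX
  obtain ⟨P', b', _, _, ⟨e'⟩, ⟨eY⟩⟩ := hY
  have : P.IsKProjective := CochainComplex.isKProjective_of_projective P b
  have : P'.IsKProjective := CochainComplex.isKProjective_of_projective P' b'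
  let i : DerivedCategory.Qh.obj ((HomotopyCategory.quotient _ _).obj P) ≅
      DerivedCategory.Qh.obj ((HomotopyCategory.quotient _ _).obj P') :=
    (DerivedCategory.quotientCompQhIso _).app P ≪≫ e ≪≫ e'.symm ≪≫
      ((DerivedCategory.quotientCompQhIso _).app P').symm
  obtain ⟨g, hg⟩ := (CochainComplex.IsKProjective.Qh_map_bijective P
    ((HomotopyCategory.quotient _ _).obj P')).surjective i.hom
  obtain ⟨h, hh⟩ := (CochainComplex.IsKProjective.Qh_map_bijective P'
    ((HomotopyCategory.quotient _ _).obj P)).surjective i.inv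
  let j : (HomotopyCategory.quotient _ _).obj P ≅ (HomotopyCategory.quotient _ _).obj P' :=
    { hom := g
      inv := h
      hom_inv_id := (CochainComplex.IsKProjective.Qh_map_bijective P _).injective (by
        rw [Functor.map_comp, hg, hh, i.hom_inv_id, CategoryTheory.Functor.map_id])
      inv_hom_id := (CochainComplex.IsKProjective.Qh_map_bijective P' _).injective (by
        rw [Functor.map_comp, hg, hh, i.inv_hom_id, CategoryTheory.Functor.map_id]) }
  let F := BaseChange.functor f
  let k : (HomotopyCategory.quotient _ (ComplexShape.up ℤ)).obj
      ((F.mapHomologicalComplex _).obj P) ≅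
      (HomotopyCategory.quotient _ _).obj ((F.mapHomologicalComplex _).obj P') :=
    (F.mapHomotopyCategory _).mapIso j
  exact ⟨eX.symm ≪≫ ((DerivedCategory.quotientCompQhIso _).app _).symm ≪≫
    DerivedCategory.Qh.mapIso k ≪≫ (DerivedCategory.quotientCompQhIso _).app _ ≪≫ eY⟩

end

section

variable {R : Type*} {Λ : Type v} [CommRing R] [Ring Λ] [Algebra R Λ] (I : Ideal R)

/-- The ideal `I Λ` of an `R`-algebra `Λ` generated by an ideal `I` of `R` is two-sided. -/
instance Ideal.isTwoSided_map_algebraMap : (I.map (algebraMap R Λ)).IsTwoSided where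
  mul_mem_of_left {a} c ha := by
    induction ha using Submodule.span_induction with
    | mem x hx =>
      obtain ⟨r, hr, rfl⟩ := hx
      rw [Algebra.commutes]
      exact Ideal.mul_mem_left _ _ (Ideal.mem_map_of_mem _ hr)
    | zero => simp
    | add x y _ _ hx hy => rw [add_mul]; exact Ideal.add_mem _ hx hy
    | smul b x _ hx => rw [smul_eq_mul, mul_assoc]; exact Ideal.mul_mem_left _ _ hx

variable (Λ) in
/-- The quotient ring `Λ / I Λ`. -/
abbrev QuotientAlgebra : Type v := Λ ⧸ I.map (algebraMap R Λ)

variable [HasDerivedCategory.{w} (RightModuleCat Λ)]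
  [HasDerivedCategory.{w'} (RightModuleCat (QuotientAlgebra Λ I))]

/-- `X` is (a model of) the derived tensor product `T ⊗^L_Λ (Λ / I Λ)` of a complex `T` of right
`Λ`-modules. Right modules are left modules over the opposite ring, hence `- ⊗_Λ (Λ / I Λ)` is base
change along the opposite of the quotient map `Λ → Λ / I Λ`. -/
def IsDerivedReduction (T : DerivedCategory (RightModuleCat Λ))
    (X : DerivedCategory (RightModuleCat (QuotientAlgebra Λ I))) : Prop :=
  IsDerivedBaseChange (RingHom.op (Ideal.Quotient.mk (I.map (algebraMap R Λ)))) T X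

end

end

/-! Represent `T` by a bounded complex `P` of finitely generated projectives, and let C be the
complex of `Cochain P P n`. Each term is finite projective over R, C is bounded above, and its n-th
cohomology is Hom(T, T[n]), which vanishes for n ≠ 0.

Exactness in positive degrees splits C there, so the cocycle module Z in degree 0 is a direct
summand of C⁰, hence finite free (`LinearMap.exists_retraction_ker_of_exact`). Exactness in degree
-1 then gives a presentation C⁻² → C⁻¹ → Z → End(T) → 0. By the local criterion, End(T) is free iff
Tor₁(End(T), k) = 0 for the residue field k, that is, iff the presentation stays exact at C⁻¹ modulo
𝔪 (`Module.free_iff_of_exact`).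

Finally, C/𝔪C is the endomorphism complex of the reduction of `P`
(`BaseChange.cochain_map_surjective`, `BaseChange.cochain_map_eq_zero_iff`), and Z ∩ 𝔪C⁰ = 𝔪Z
because Z is a summand. So the condition says that the reduced complex has no cohomology in degree
-1. -/

/-! ### Linear algebra over a commutative, later local, ring. -/

section LinearAlgebra

open IsLocalRing TensorProduct

variable {R : Type*} [CommRing R]

/-- If the range of a linear map is projective, then its kernel is a retract. -/
lemma LinearMap.exists_retraction_ker {M N : Type*} [AddCommGroup M] [AddCommGroup N]
    [Module R M] [Module R N] (f : M →ₗ[R] N) [Module.Projective R (LinearMap.range f)] :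
    ∃ r : M →ₗ[R] LinearMap.ker f, r ∘ₗ (LinearMap.ker f).subtype = LinearMap.id := by
  obtain ⟨s, hs⟩ := Module.projective_lifting_property f.rangeRestrict LinearMap.id
    f.surjective_rangeRestrict
  refine ⟨LinearMap.codRestrict _ (LinearMap.id - s ∘ₗ f.rangeRestrict) fun x ↦ ?_, ?_⟩
  · have := congr_arg Subtype.val (LinearMap.congr_fun hs (f.rangeRestrict x))
    simp only [LinearMap.comp_apply, LinearMap.id_apply, LinearMap.codRestrict_apply] at this
    simp [LinearMap.mem_ker, this]
  · ext x
    have : f.rangeRestrict x = 0 := Subtype.ext x.2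
    simp [this]

/-- In a bounded above complex of projective modules which is exact in positive degrees, the kernel
in degree zero is a retract. -/
lemma LinearMap.exists_retraction_ker_of_exact {M : ℤ → Type*} [∀ n, AddCommGroup (M n)]
    [∀ n, Module R (M n)] [∀ n, Module.Projective R (M n)] (d : ∀ n, M n →ₗ[R] M (n + 1))
    (hd : ∀ n, 0 ≤ n → LinearMap.range (d n) = LinearMap.ker (d (n + 1)))
    (N : ℤ) (hN : ∀ n, N ≤ n → Subsingleton (M n)) :
    ∃ r : M 0 →ₗ[R] LinearMap.ker (d 0), r ∘ₗ (LinearMap.ker (d 0)).subtype = LinearMap.id := by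
  -- Descending induction on `n` from `N`, with `j` bounding the distance: if the range of `d (n +
  -- 1)` is projective, its kernel, which is the range of `d n`, is a retract of `M (n + 1)`.
  have key (j : ℕ) : ∀ n : ℤ, 0 ≤ n → N ≤ n + j → Module.Projective R (LinearMap.range (d n)) := by
    induction j with
    | zero =>
      intro n _ hn
      have := hN (n + 1) (by omega)
      infer_instance
    | succ j ih =>
      intro n h0 hn
      have := ih (n + 1) (by omega) (by push_cast at hn; omega)
      obtain ⟨r, hr⟩ := (d (n + 1)).exists_retraction_ker
      rw [hd n h0]
      exact Module.Projective.of_split _ r hr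
  have := key N.toNat 0 le_rfl (by simp)
  exact (d 0).exists_retraction_ker

/-- Given a presentation `L → M → Z → H → 0` with `Z` finite free over a noetherian local ring,
the module `H` is free if and only if the presentation stays exact at `M` modulo the maximal
ideal. -/
lemma Module.free_iff_of_exact [IsNoetherianRing R] [IsLocalRing R]
    {L M Z H : Type*} [AddCommGroup L] [AddCommGroup M] [AddCommGroup Z] [AddCommGroup H]
    [Module R L] [Module R M] [Module R Z] [Module R H] [Module.Finite R Z] [Module.Free R Z]
    (a : L →ₗ[R] M) (b : M →ₗ[R] Z) (p : Z →ₗ[R] H) (hab : Function.Exact a b)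
    (hbp : Function.Exact b p) (hp : Function.Surjective p) :
    Module.Free R H ↔ ∀ x, b x ∈ maximalIdeal R • (⊤ : Submodule R Z) →
      ∃ y, x - a y ∈ maximalIdeal R • (⊤ : Submodule R M) := by
  constructor
  · intro hH x hx
    obtain ⟨s, hs⟩ := Module.projective_lifting_property p LinearMap.id hp
    -- The splitting `s` makes `ρ` a projection onto the range of `b`, so an element of that range
    -- lying in 𝔪Z already lies in 𝔪 times the range.
    let ρ : Z →ₗ[R] LinearMap.range b := LinearMap.codRestrict _ (LinearMap.id - s ∘ₗ p) fun z ↦ by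
      rw [LinearMap.mem_range]
      refine (hbp _).1 ?_
      have := LinearMap.congr_fun hs (p z)
      simp only [LinearMap.comp_apply, LinearMap.id_apply] at this
      simp [this]
    have hρ : ρ (b x) = b.rangeRestrict x := by
      ext
      simp [ρ, hbp.apply_apply_eq_zero]
    have h1 : ρ (b x) ∈ (maximalIdeal R • (⊤ : Submodule R M)).map b.rangeRestrict := by
      rw [Submodule.map_smul'', Submodule.map_top, LinearMap.range_rangeRestrict]
      have := Submodule.mem_map_of_mem (f := ρ) hx
      rw [Submodule.map_smul''] at this
      exact Submodule.smul_mono le_rfl le_top this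
    obtain ⟨x', hx', h2⟩ := h1
    rw [hρ] at h2
    have h3 : b (x - x') = 0 := by
      rw [map_sub, sub_eq_zero]
      exact (congr_arg Subtype.val h2).symm
    obtain ⟨y, hy⟩ := (hab _).1 h3
    exact ⟨y, by rw [hy]; simpa using hx'⟩
  · intro h
    -- Local criterion: it suffices that the inclusion of the range of `b` into `Z` stays injective
    -- after tensoring with the residue field.
    refine Module.free_of_lTensor_residueField_injective (LinearMap.range b).subtype p hp ?_ ?_
    · intro z
      rw [hbp z]
      simp
    · rw [injective_iff_map_eq_zero]
      intro t ht
      obtain ⟨⟨_, x, rfl⟩, rfl⟩ :=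
        TensorProduct.mk_surjective R (LinearMap.range b) (ResidueField R)
          Ideal.Quotient.mk_surjective t
      have h1 : b x ∈ LinearMap.ker (TensorProduct.mk R (ResidueField R) Z 1) := by
        simpa using ht
      erw [LinearMap.ker_tensorProductMk] at h1
      obtain ⟨y, hy⟩ := h x h1
      rw [← LinearMap.mem_ker]
      erw [LinearMap.ker_tensorProductMk]
      have h2 := Submodule.mem_map_of_mem (f := b.rangeRestrict) hy
      rw [Submodule.map_smul''] at h2
      have h3 : b.rangeRestrict (x - a y) = ⟨b x, x, rfl⟩ := by
        ext
        simp [hab.apply_apply_eq_zero]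
      rw [h3] at h2
      exact Submodule.smul_mono le_rfl le_top h2

/-- A finite product of projective modules is projective. -/
lemma Module.Projective.pi_of_finite {ι : Type*} [Finite ι] (M : ι → Type*)
    [∀ i, AddCommGroup (M i)] [∀ i, Module R (M i)] [∀ i, Module.Projective R (M i)] :
    Module.Projective R (∀ i, M i) := by
  classical
  have := Fintype.ofFinite ι
  exact Module.Projective.of_equiv (DFinsupp.linearEquivFunOnFintype (R := R) (M := M))

/-- A noncommutative version of the finiteness and projectivity of modules of linear maps. -/
lemma LinearMap.finite_and_projective_of_algebra {A X Y : Type*} [Ring A] [Algebra R A]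
    [AddCommGroup X] [AddCommGroup Y] [Module A X] [Module A Y] [Module R Y] [SMulCommClass A R Y]
    [Module.Finite A X] [Module.Projective A X] [Module.Finite R Y] [Module.Projective R Y] :
    Module.Finite R (X →ₗ[A] Y) ∧ Module.Projective R (X →ₗ[A] Y) := by
  obtain ⟨n, p, hp⟩ := Module.Finite.exists_fin' A X
  obtain ⟨s, hs⟩ := Module.projective_lifting_property p LinearMap.id hp
  -- `X` is a retract of Aⁿ, so Hom(X, Y) is a retract over `R` of Hom(Aⁿ, Y) ≅ Yⁿ.
  let e := (Pi.basisFun A (Fin n)).constr R (M' := Y)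
  let i : (X →ₗ[A] Y) →ₗ[R] (Fin n → Y) := e.symm.toLinearMap ∘ₗ
    { toFun := fun g ↦ g ∘ₗ p, map_add' := fun _ _ ↦ rfl, map_smul' := fun _ _ ↦ rfl }
  let q : (Fin n → Y) →ₗ[R] (X →ₗ[A] Y) :=
    { toFun := fun g ↦ g ∘ₗ s, map_add' := fun _ _ ↦ rfl, map_smul' := fun _ _ ↦ rfl } ∘ₗ
      e.toLinearMap
  have := Module.Projective.pi_of_finite (R := R) fun _ : Fin n ↦ Y
  have hq : q ∘ₗ i = LinearMap.id := by
    ext g x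
    simpa [q, i] using congr_arg g (LinearMap.congr_fun hs x)
  refine ⟨Module.Finite.of_surjective q fun g ↦ ⟨i g, LinearMap.congr_fun hq g⟩,
    Module.Projective.of_split _ _ hq⟩

end LinearAlgebra

/-! ### Modules under base change along a ring morphism. -/

namespace BaseChange

section

variable {A B : Type v} [Ring A] [Ring B] (f : A →+* B)

/-- The canonical semilinear map `M → B ⊗_A M`. -/
def unit (M : Type v) [AddCommGroup M] [Module A M] : M →ₛₗ[f] Tensor f M where
  toFun m := (relations f M).mkQ (1 ⊗ₜ[ℤ] m)
  map_add' m m' := by rw [TensorProduct.tmul_add, _root_.map_add]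
  map_smul' a m := by
    rw [← _root_.map_smul, eq_comm, ← sub_eq_zero, ← _root_.map_sub, ← LinearMap.mem_ker,
      Submodule.ker_mkQ]
    exact Submodule.subset_span ⟨1, a, m, by simp [TensorProduct.smul_tmul']⟩

lemma map_unit {M N : Type v} [AddCommGroup M] [AddCommGroup N] [Module A M] [Module A N]
    (g : M →ₗ[A] N) (m : M) : map f g (unit f M m) = unit f N (g m) := rfl

lemma mk_tmul_eq_smul_unit {M : Type v} [AddCommGroup M] [Module A M] (b : B) (m : M) :
    (relations f M).mkQ (b ⊗ₜ[ℤ] m) = b • unit f M m := by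
  change _ = b • (relations f M).mkQ (1 ⊗ₜ[ℤ] m)
  rw [← _root_.map_smul, TensorProduct.smul_tmul', smul_eq_mul, mul_one]

lemma linearMap_ext_unit {M N : Type v} [AddCommGroup M] [AddCommGroup N] [Module A M] [Module B N]
    {g h : Tensor f M →ₗ[B] N} (H : ∀ m : M, g (unit f M m) = h (unit f M m)) : g = h :=
  linearMap_ext f fun b m ↦ by
    rw [mk_tmul_eq_smul_unit, _root_.map_smul, _root_.map_smul, H]

lemma unit_surjective (hf : Function.Surjective f) (M : Type v) [AddCommGroup M] [Module A M] :
    Function.Surjective (unit f M) := by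
  intro x
  obtain ⟨y, rfl⟩ := (relations f M).mkQ_surjective x
  induction y using TensorProduct.induction_on with
  | zero => exact ⟨0, by simp only [_root_.map_zero]⟩
  | tmul b m =>
    obtain ⟨a, rfl⟩ := hf b
    exact ⟨a • m, by rw [mk_tmul_eq_smul_unit, LinearMap.map_smulₛₗ]⟩
  | add y z hy hz =>
    obtain ⟨y', hy⟩ := hy
    obtain ⟨z', hz⟩ := hz
    exact ⟨y' + z', by rw [_root_.map_add, hy, hz, _root_.map_add]⟩

variable {f} in
/-- The linear map `B ⊗_A M → N` induced by a semilinear map `M → N`. -/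
def lift {M N : Type v} [AddCommGroup M] [AddCommGroup N] [Module A M] [Module B N]
    (g : M →ₛₗ[f] N) : Tensor f M →ₗ[B] N :=
  (relations f M).liftQ
    (TensorProduct.AlgebraTensorModule.lift
      { toFun := fun b ↦
          { toFun := fun m ↦ b • g m
            map_add' := fun m m' ↦ by rw [_root_.map_add, smul_add]
            map_smul' := fun r m ↦ by
              rw [map_zsmul, RingHom.id_apply, smul_comm] }
        map_add' := fun b b' ↦ by ext m; exact add_smul b b' (g m)
        map_smul' := fun b b' ↦ by ext m; exact mul_smul b b' (g m) }) (by
    refine Submodule.span_le.2 ?_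
    rintro _ ⟨b, a, m, rfl⟩
    simp [mul_smul])

variable {f} in
@[simp]
lemma lift_unit {M N : Type v} [AddCommGroup M] [AddCommGroup N] [Module A M] [Module B N]
    (g : M →ₛₗ[f] N) (m : M) : lift g (unit f M m) = g m :=
  one_smul B (g m)

variable {f} in
/-- Semilinear maps out of a projective module lift along surjective linear maps. -/
lemma exists_semilinear_lift {P M N : Type v} [AddCommGroup P] [AddCommGroup M] [AddCommGroup N]
    [Module A P] [Module B M] [Module B N] [Module.Projective A P] (p : M →ₗ[B] N)
    (hp : Function.Surjective p) (g : P →ₛₗ[f] N) : ∃ h : P →ₛₗ[f] M, ∀ x, p (h x) = g x := by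
  -- Restricting scalars along `f` turns semilinear maps into `A`-linear ones.
  let _ : Module A M := Module.compHom M f
  let _ : Module A N := Module.compHom N f
  let p' : M →ₗ[A] N := { p.toAddMonoidHom with map_smul' := fun a x ↦ p.map_smul (f a) x }
  let g' : P →ₗ[A] N := { g.toAddMonoidHom with map_smul' := fun a x ↦ g.map_smulₛₗ a x }
  obtain ⟨h, hh⟩ := Module.projective_lifting_property p' g' hp
  exact ⟨{ h.toAddMonoidHom with map_smul' := fun a x ↦ h.map_smul a x }, LinearMap.congr_fun hh⟩

instance projective_tensor (P : Type v) [AddCommGroup P] [Module A P] [Module.Projective A P] :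
    Module.Projective B (Tensor f P) := by
  refine Module.Projective.of_lifting_property'' fun p hp ↦ ?_
  obtain ⟨h, hh⟩ := exists_semilinear_lift p hp (unit f P)
  exact ⟨lift h, linearMap_ext_unit f fun m ↦ by simp [hh]⟩

/-- Base change along a surjective ring morphism is full on morphisms from projective modules. -/
lemma map_surjective (hf : Function.Surjective f) {P Q : Type v} [AddCommGroup P] [AddCommGroup Q]
    [Module A P] [Module A Q] [Module.Projective A P] (h : Tensor f P →ₗ[B] Tensor f Q) :
    ∃ g : P →ₗ[A] Q, map f g = h := by
  let _ : Module A (Tensor f P) := Module.compHom _ f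
  let _ : Module A (Tensor f Q) := Module.compHom _ f
  let π : Q →ₗ[A] Tensor f Q :=
    { (unit f Q).toAddMonoidHom with map_smul' := fun a x ↦ (unit f Q).map_smulₛₗ a x }
  let h' : P →ₗ[A] Tensor f Q :=
    { (h.toAddMonoidHom.comp (unit f P).toAddMonoidHom) with
      map_smul' := fun a x ↦ (h.comp (unit f P)).map_smulₛₗ a x }
  obtain ⟨g, hg⟩ := Module.projective_lifting_property π h' (unit_surjective f hf Q)
  exact ⟨g, linearMap_ext_unit f fun m ↦ LinearMap.congr_fun hg m⟩

/-- The kernel of `M → B ⊗_A M` for a surjective ring morphism `A → B` is contained in every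
submodule `N` such that `M ⧸ N` is annihilated by the kernel of `A → B`. -/
lemma mem_of_unit_eq_zero (hf : Function.Surjective f) {M : Type v} [AddCommGroup M] [Module A M]
    (N : Submodule A M) (hN : ∀ a, f a = 0 → ∀ m : M, a • m ∈ N) {m : M} (hm : unit f M m = 0) :
    m ∈ N := by
  -- The kernel of `f` kills `M ⧸ N`, so acting through arbitrary preimages makes it a `B`-module;
  -- the projection from `M` then factors through `unit`.
  let _ : SMul B (M ⧸ N) := ⟨fun b x ↦ Function.surjInv hf b • x⟩
  have hsmul (a : A) (x : M ⧸ N) : f a • x = a • x := by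
    obtain ⟨x, rfl⟩ := N.mkQ_surjective x
    change Function.surjInv hf (f a) • N.mkQ x = a • N.mkQ x
    rw [← sub_eq_zero, ← sub_smul, ← _root_.map_smul, ← LinearMap.mem_ker, Submodule.ker_mkQ]
    exact hN _ (by rw [_root_.map_sub, Function.surjInv_eq hf, sub_self]) x
  let _ : Module B (M ⧸ N) := Function.Surjective.moduleLeft f hf hsmul
  let q : M →ₛₗ[f] M ⧸ N :=
    { N.mkQ.toAddMonoidHom with
      map_smul' := fun a x ↦ (N.mkQ.map_smul a x).trans (hsmul a _).symm }
  have := lift_unit q m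
  rw [hm, _root_.map_zero] at this
  exact (Submodule.Quotient.mk_eq_zero N).1 this.symm

end

end BaseChange

section

variable {R : Type*} {A B : Type v} [CommRing R] [Ring A] [Ring B] [Algebra R A] (f : A →+* B)

open BaseChange in
/-- If `A → B` is surjective with kernel generated by central elements `r i`, then a morphism of
projective modules which vanishes after base change is a combination of the `r i`. -/
lemma BaseChange.exists_eq_sum_of_map_eq_zero (hf : Function.Surjective f) {ι : Type*} [Fintype ι]
    (r : ι → R) (hr : ∀ a, f a = 0 → ∃ c : ι → A, a = ∑ i, r i • c i)
    {P Q : ModuleCat.{v} A} [Module.Projective A P] (g : P ⟶ Q)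
    (hg : (BaseChange.functor f).map g = 0) :
    ∃ c : ι → (P ⟶ Q), g = ∑ i, r i • c i := by
  -- The range of `s` is ∑ rᵢQ, which contains the image of `g`; lifting `g` through `s` by
  -- projectivity of `P` yields the coefficients.
  let s : (ι → Q) →ₗ[A] Q := ∑ i, r i • LinearMap.proj i
  have hs (y : ι → Q) : s y = ∑ i, r i • y i := by simp [s]
  have hmem (x : P) : g.hom x ∈ LinearMap.range s := by
    refine mem_of_unit_eq_zero f hf _ ?_ ?_
    · intro a ha m
      obtain ⟨c, rfl⟩ := hr a ha
      exact ⟨fun i ↦ c i • m, by simp [hs, Finset.sum_smul]⟩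
    · rw [← map_unit]
      exact LinearMap.congr_fun (congr_arg ModuleCat.Hom.hom hg) (unit f P x)
  obtain ⟨h, hh⟩ := Module.projective_lifting_property s.rangeRestrict
    (LinearMap.codRestrict _ g.hom hmem) s.surjective_rangeRestrict
  refine ⟨fun i ↦ ModuleCat.ofHom (LinearMap.proj i ∘ₗ h), ?_⟩
  ext x
  have := congr_arg Subtype.val (LinearMap.congr_fun hh x)
  simp only [LinearMap.comp_apply, LinearMap.codRestrict_apply] at this
  change s (h x) = _ at this
  rw [← this, hs]
  simp

end

/-! ### Complexes of morphisms: reduction modulo an ideal, and finiteness. -/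

open CochainComplex HomComplex

section

variable {R : Type*} {A B : Type v} [CommRing R] [Ring A] [Ring B] [Algebra R A] (f : A →+* B)

lemma BaseChange.functor_map_smul_eq_zero {P Q : ModuleCat.{v} A} (r : R)
    (hr : f (algebraMap R A r) = 0) (g : P ⟶ Q) : (BaseChange.functor f).map (r • g) = 0 := by
  ext1
  refine BaseChange.linearMap_ext_unit f fun m ↦ ?_
  change BaseChange.unit f Q (algebraMap R A r • g.hom m) = 0
  rw [LinearMap.map_smulₛₗ, hr, zero_smul]

/-- A cochain is a family of morphisms with no compatibility, so `BaseChange.map_surjective` applies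
to each component separately. -/
lemma BaseChange.cochain_map_surjective (hf : Function.Surjective f)
    {P Q : CochainComplex (ModuleCat.{v} A) ℤ} [∀ n, Module.Projective A (P.X n)] (n : ℤ) :
    Function.Surjective fun z : Cochain P Q n ↦ z.map (BaseChange.functor f) := by
  intro z
  have (T : Triplet n) := BaseChange.map_surjective f hf (z.v T.p T.q T.hpq).hom
  choose c hc using this
  refine ⟨Cochain.mk fun p q h ↦ ModuleCat.ofHom (c ⟨p, q, h⟩), ?_⟩
  ext p q h : 2
  exact hc ⟨p, q, h⟩

/-- The kernel of the base change map on cochains. -/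
lemma BaseChange.cochain_map_eq_zero_iff [IsNoetherianRing R] (I : Ideal R)
    (hf : Function.Surjective f) (hI : RingHom.ker f = I.map (algebraMap R A))
    {P Q : CochainComplex (ModuleCat.{v} A) ℤ} [∀ n, Module.Projective A (P.X n)] {n : ℤ}
    (z : Cochain P Q n) :
    z.map (BaseChange.functor f) = 0 ↔ z ∈ I • (⊤ : Submodule R (Cochain P Q n)) := by
  constructor
  · intro hz
    -- A cochain may have infinitely many components. One finite list of generators for all of them
    -- lets the componentwise expressions assemble into a finite sum.
    obtain ⟨k, r, rfl⟩ := Submodule.fg_iff_exists_fin_generating_family.1 (IsNoetherian.noetherian I)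
    have hr (a : A) (ha : f a = 0) : ∃ c : Fin k → A, a = ∑ i, r i • c i := by
      have h1 : a ∈ RingHom.ker f := ha
      rw [hI] at h1
      have h2 : (Submodule.span R (Set.range r)).map (Algebra.linearMap R A) ≤
          (Submodule.span A (Set.range (algebraMap R A ∘ r))).restrictScalars R := by
        rw [Submodule.map_span_le]
        rintro _ ⟨i, rfl⟩
        exact Submodule.subset_span ⟨i, rfl⟩
      have h3 : a ∈ Submodule.span A (Set.range (algebraMap R A ∘ r)) := by
        refine (Ideal.map_le_iff_le_comap (K := Submodule.span A _)).2 (fun x hx ↦ ?_) h1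
        exact h2 ⟨x, hx, rfl⟩
      obtain ⟨c, rfl⟩ := (Submodule.mem_span_range_iff_exists_fun A).1 h3
      exact ⟨c, Finset.sum_congr rfl fun i _ ↦ by
        rw [smul_eq_mul, Function.comp_apply, ← Algebra.commutes, Algebra.smul_def]⟩
    have (T : Triplet n) := BaseChange.exists_eq_sum_of_map_eq_zero f hf r hr (z.v T.p T.q T.hpq)
      (Cochain.congr_v hz T.p T.q T.hpq)
    choose c hc using this
    have hsum : z = ∑ i, r i • (fun T ↦ c T i : Cochain P Q n) := by
      funext T
      refine (hc T).trans ?_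
      exact (Finset.sum_apply T Finset.univ
        fun i ↦ (r i • (fun T ↦ c T i : Cochain P Q n) :
          (T : Triplet n) → (P.X T.p ⟶ Q.X T.q))).symm
    rw [hsum]
    exact Submodule.sum_mem _ fun i _ ↦ Submodule.smul_mem_smul (Submodule.subset_span ⟨i, rfl⟩)
      Submodule.mem_top
  · intro hz
    induction hz using Submodule.smul_induction_on' with
    | smul r hr z _ =>
      ext p q h : 1
      refine BaseChange.functor_map_smul_eq_zero f r ?_ _
      rw [← RingHom.mem_ker, hI]
      exact Ideal.mem_map_of_mem _ hr
    | add x _ y _ hx hy => rw [Cochain.map_add, hx, hy, add_zero]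

/-- Exactness of the complex of morphisms after base change, in terms of the original complex. -/
lemma BaseChange.exact_cochain_iff [IsNoetherianRing R] (I : Ideal R)
    (hf : Function.Surjective f) (hI : RingHom.ker f = I.map (algebraMap R A))
    {P Q : CochainComplex (ModuleCat.{v} A) ℤ} [∀ n, Module.Projective A (P.X n)] (m n k : ℤ) :
    (∀ z : Cochain (((BaseChange.functor f).mapHomologicalComplex (ComplexShape.up ℤ)).obj P)
      (((BaseChange.functor f).mapHomologicalComplex (ComplexShape.up ℤ)).obj Q) n,
      δ n k z = 0 → ∃ y, δ m n y = z) ↔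
    ∀ z : Cochain P Q n, δ n k z ∈ I • (⊤ : Submodule R (Cochain P Q k)) →
      ∃ y, z - δ m n y ∈ I • (⊤ : Submodule R (Cochain P Q n)) := by
  simp only [← BaseChange.cochain_map_eq_zero_iff f I hf hI]
  constructor
  · intro H z hz
    obtain ⟨y, hy⟩ := H (z.map _) (by rw [δ_map, hz])
    obtain ⟨y, rfl⟩ := BaseChange.cochain_map_surjective f hf m y
    exact ⟨y, by rw [Cochain.map_sub, ← δ_map, hy, sub_self]⟩
  · intro H z hz
    obtain ⟨z, rfl⟩ := BaseChange.cochain_map_surjective f hf n z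
    obtain ⟨y, hy⟩ := H z (by rw [← δ_map]; exact hz)
    refine ⟨y.map _, ?_⟩
    rw [Cochain.map_sub, sub_eq_zero] at hy
    rw [δ_map, ← hy]

lemma Module.Projective.restrictScalars_of_algebra {A Y : Type*} [Ring A] [Algebra R A]
    [AddCommGroup Y] [Module A Y] [Module R Y] [IsScalarTower R A Y] [Module.Free R A]
    [Module.Projective A Y] : Module.Projective R Y := by
  obtain ⟨s, hs⟩ := Module.projective_def'.1 (inferInstance : Module.Projective A Y)
  exact Module.Projective.of_split (s.restrictScalars R)
    ((Finsupp.linearCombination A id).restrictScalars R)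
    (LinearMap.ext fun x ↦ LinearMap.congr_fun hs x)

variable [Module.Finite R A] [Module.Free R A]

lemma ModuleCat.finite_and_projective_hom (X Y : ModuleCat.{v} A)
    [Module.Finite A X] [Module.Finite A Y] [Module.Projective A X] [Module.Projective A Y] :
    Module.Finite R (X ⟶ Y) ∧ Module.Projective R (X ⟶ Y) := by
  have : Module.Finite R Y := Module.Finite.trans A Y
  have : Module.Projective R Y := Module.Projective.restrictScalars_of_algebra (A := A)
  obtain ⟨h₁, h₂⟩ := LinearMap.finite_and_projective_of_algebra (R := R) (A := A) (X := X) (Y := Y)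
  exact ⟨Module.Finite.equiv (ModuleCat.homLinearEquiv (S := R) (M := X) (N := Y)).symm,
    Module.Projective.of_equiv (ModuleCat.homLinearEquiv (S := R) (M := X) (N := Y)).symm⟩

/-- Cochains of bounded complexes of finitely generated projective modules form a finitely
generated projective module. -/
lemma CochainComplex.HomComplex.Cochain.finite_and_projective
    (P Q : CochainComplex (ModuleCat.{v} A) ℤ) (a b : ℤ)
    [P.IsStrictlyGE a] [P.IsStrictlyLE b] [∀ n, Module.Finite A (P.X n)]
    [∀ n, Module.Finite A (Q.X n)] [∀ n, Module.Projective A (P.X n)]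
    [∀ n, Module.Projective A (Q.X n)] (n : ℤ) :
    Module.Finite R (Cochain P Q n) ∧ Module.Projective R (Cochain P Q n) := by
  classical
  let S := {T : Triplet n // a ≤ T.p ∧ T.p ≤ b}
  -- A triplet is determined by its source degree. Those with source outside [a, b] contribute zero,
  -- so the cochains are a retract of a finite product.
  have : Finite S := Finite.of_injective (β := Set.Icc a b) (fun T ↦ ⟨T.1.p, T.2⟩) (by
    rintro ⟨⟨p, q, h⟩, _⟩ ⟨⟨p', q', h'⟩, _⟩ hT
    obtain rfl : p = p' := congr_arg Subtype.val hT
    subst h h'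
    rfl)
  have h₁ (T : S) : Module.Finite R (P.X T.1.p ⟶ Q.X T.1.q) :=
    (ModuleCat.finite_and_projective_hom _ _).1
  have h₂ (T : S) : Module.Projective R (P.X T.1.p ⟶ Q.X T.1.q) :=
    (ModuleCat.finite_and_projective_hom _ _).2
  have := Module.Projective.pi_of_finite (R := R) fun T : S ↦ (P.X T.1.p ⟶ Q.X T.1.q)
  let i : (∀ T : Triplet n, (P.X T.p ⟶ Q.X T.q)) →ₗ[R] (∀ T : S, (P.X T.1.p ⟶ Q.X T.1.q)) :=
    LinearMap.pi fun T ↦ LinearMap.proj T.1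
  let q : (∀ T : S, (P.X T.1.p ⟶ Q.X T.1.q)) →ₗ[R] (∀ T : Triplet n, (P.X T.p ⟶ Q.X T.q)) :=
    LinearMap.pi fun T ↦ if h : a ≤ T.p ∧ T.p ≤ b then LinearMap.proj (⟨T, h⟩ : S) else 0
  have hq : q ∘ₗ i = LinearMap.id := by
    refine LinearMap.ext fun z ↦ funext fun T ↦ ?_
    by_cases h : a ≤ T.p ∧ T.p ≤ b
    · simp [q, i, dif_pos h]
    · have : Limits.IsZero (P.X T.p) := by
        by_cases h' : a ≤ T.p
        · exact P.isZero_of_isStrictlyLE b _ (by omega)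
        · exact P.isZero_of_isStrictlyGE a _ (by omega)
      exact this.eq_of_src _ _
  have h₃ := Module.Finite.of_surjective q fun z ↦ ⟨i z, LinearMap.congr_fun hq z⟩
  have h₄ := Module.Projective.of_split i q hq
  exact ⟨h₃, h₄⟩

end

lemma CochainComplex.HomComplex.Cochain.subsingleton_of_isStrictlyGE_of_isStrictlyLE
    {C : Type*} [Category* C] [Preadditive C] (P Q : CochainComplex C ℤ) (a b n : ℤ)
    [P.IsStrictlyGE a] [Q.IsStrictlyLE b] (hn : b - a < n) : Subsingleton (Cochain P Q n) where
  allEq z z' := by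
    ext p q h : 1
    by_cases h' : a ≤ p
    · exact (Q.isZero_of_isStrictlyLE b q (by omega)).eq_of_tgt _ _
    · exact (P.isZero_of_isStrictlyGE a p (by omega)).eq_of_src _ _

/-! ### Morphisms in the derived category via cochains. -/

open CochainComplex HomComplex

noncomputable section

section

variable {C : Type*} [Category* C] [Abelian C] [HasDerivedCategory.{w} C]

/-- Vanishing of shifted morphisms in the derived category from a K-projective complex, in terms
of cochains. -/
lemma DerivedCategory.forall_shiftedHom_eq_zero_iff {T : DerivedCategory C}
    {K : CochainComplex C ℤ} [K.IsKProjective] (e : DerivedCategory.Q.obj K ≅ T) (m n k : ℤ)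
    (hmn : m + 1 = n) (hnk : n + 1 = k) :
    (∀ φ : T ⟶ T⟦n⟧, φ = 0) ↔ ∀ z : Cochain K K n, δ n k z = 0 → ∃ y, δ m n y = z := by
  have e₁ : (T ⟶ T⟦n⟧) ≃ CohomologyClass K K n :=
    (Iso.homCongr (e.symm ≪≫ (quotientCompQhIso C).symm.app K)
      ((CategoryTheory.shiftFunctor _ n).mapIso e.symm ≪≫ (Q.commShiftIso n).symm.app K ≪≫
        (quotientCompQhIso C).symm.app (K⟦n⟧))).trans
      ((Equiv.ofBijective _ (IsKProjective.Qh_map_bijective K _)).symm.trans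
        (CohomologyClass.homAddEquiv (K := K) (L := K) (n := n)).symm.toEquiv)
  trans Subsingleton (CohomologyClass K K n)
  · rw [← e₁.subsingleton_congr, subsingleton_iff_forall_eq 0]
  · rw [subsingleton_iff_forall_eq 0]
    constructor
    · intro h z hz
      exact (mem_coboundaries_iff _ m hmn).1
        ((CohomologyClass.mk_eq_zero_iff (Cocycle.mk z k hnk hz)).1 (h _))
    · intro h x
      obtain ⟨z, rfl⟩ := x.mk_surjective
      exact (CohomologyClass.mk_eq_zero_iff z).2
        ((mem_coboundaries_iff _ m hmn).2 (h z.1 (z.δ_eq_zero k)))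

variable {R : Type*} [CommRing R] [Linear R C] {T : DerivedCategory C} {K : CochainComplex C ℤ}

/-- The linear map sending a cocycle of degree zero to the induced endomorphism in the derived
category. -/
def DerivedCategory.endOfCocycle (e : DerivedCategory.Q.obj K ≅ T) :
    LinearMap.ker (δ_hom R K K 0 1) →ₗ[R] End T where
  toFun z := e.inv ≫ Q.map (Cocycle.homOf (Cocycle.mk z.1 1 (zero_add 1) z.2)) ≫ e.hom
  map_add' z z' := by
    rw [show Cocycle.homOf (Cocycle.mk (z + z').1 1 (zero_add 1) (z + z').2) =
      Cocycle.homOf (Cocycle.mk z.1 1 (zero_add 1) z.2) +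
        Cocycle.homOf (Cocycle.mk z'.1 1 (zero_add 1) z'.2) from rfl]
    simp
  map_smul' r z := by
    rw [show Cocycle.homOf (Cocycle.mk (r • z).1 1 (zero_add 1) (r • z).2) =
      r • Cocycle.homOf (Cocycle.mk z.1 1 (zero_add 1) z.2) from rfl]
    simp

lemma DerivedCategory.Q_map_surjective [K.IsKProjective] (L : CochainComplex C ℤ)
    (φ : Q.obj K ⟶ Q.obj L) : ∃ g : K ⟶ L, Q.map g = φ := by
  obtain ⟨g, hg⟩ := (IsKProjective.Qh_map_bijective K _).surjective
    ((quotientCompQhIso C).hom.app K ≫ φ ≫ (quotientCompQhIso C).inv.app L)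
  obtain ⟨g, rfl⟩ := (HomotopyCategory.quotient _ _).map_surjective g
  refine ⟨g, ?_⟩
  rw [← cancel_epi ((quotientCompQhIso C).hom.app K), ← quotientCompQhIso_hom_naturality, hg]
  simp

/-- For K-projective `K`, localization is faithful on homotopy classes out of `K`, and a
null-homotopy is a cochain of degree -1 with coboundary `g`. -/
lemma DerivedCategory.Q_map_eq_zero_iff [K.IsKProjective] {L : CochainComplex C ℤ} (g : K ⟶ L) :
    Q.map g = 0 ↔ ∃ y : Cochain K L (-1), δ (-1) 0 y = Cochain.ofHom g := by
  rw [← cancel_epi ((quotientCompQhIso C).hom.app K), ← quotientCompQhIso_hom_naturality,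
    Limits.comp_zero, ← Limits.zero_comp (f := (quotientCompQhIso C).hom.app L), cancel_mono,
    ← Qh.map_zero, (IsKProjective.Qh_map_bijective K _).injective.eq_iff,
    HomotopyCategory.quotient_map_eq_zero_iff]
  constructor
  · rintro ⟨h⟩
    obtain ⟨y, hy⟩ := Cochain.equivHomotopy _ _ h
    exact ⟨y, by simpa using hy.symm⟩
  · rintro ⟨y, hy⟩
    exact ⟨(Cochain.equivHomotopy _ _).symm ⟨y, by simpa using hy.symm⟩⟩

lemma DerivedCategory.endOfCocycle_surjective [K.IsKProjective] (e : Q.obj K ≅ T) :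
    Function.Surjective (endOfCocycle (R := R) e) := by
  intro φ
  obtain ⟨g, hg⟩ := Q_map_surjective K (e.hom ≫ φ ≫ e.inv)
  refine ⟨⟨Cochain.ofHom g, δ_ofHom g⟩, ?_⟩
  change e.inv ≫ Q.map (Cocycle.homOf (Cocycle.ofHom g)) ≫ e.hom = φ
  rw [Cocycle.homOf_ofHom_eq_self, hg]
  simp

/-- With `endOfCocycle_surjective`, this presents End(T) as degree 0 cocycles modulo coboundaries,
`R`-linearly. -/
lemma DerivedCategory.endOfCocycle_eq_zero_iff [K.IsKProjective] (e : Q.obj K ≅ T)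
    (z : LinearMap.ker (δ_hom R K K 0 1)) :
    endOfCocycle e z = 0 ↔ ∃ y : Cochain K K (-1), δ (-1) 0 y = z.1 := by
  have : endOfCocycle e z = 0 ↔
      Q.map (Cocycle.homOf (Cocycle.mk z.1 1 (zero_add 1) z.2)) = 0 := by
    change e.inv ≫ Q.map (Cocycle.homOf (Cocycle.mk z.1 1 (zero_add 1) z.2)) ≫ e.hom = 0 ↔ _
    simp
  rw [this, Q_map_eq_zero_iff, Cocycle.cochain_ofHom_homOf_eq_coe]
  rfl

end

/-! ### The freeness criterion for pretilting complexes. -/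

section

variable {R : Type*} {A B : Type v} [CommRing R] [IsNoetherianRing R] [IsLocalRing R]
  [Ring A] [Ring B] [Algebra R A] [Module.Finite R A] [Module.Free R A]
  [HasDerivedCategory.{w} (ModuleCat.{v} A)] [HasDerivedCategory.{w'} (ModuleCat.{v} B)]

/-- The endomorphism algebra of a pretilting complex is free over the base ring if and only if
the reduction of the complex has no self-extensions in degree `-1`. -/
lemma IsPretiltingComplex.free_end_iff (f : A →+* B) (hf : Function.Surjective f)
    (hI : RingHom.ker f = (IsLocalRing.maximalIdeal R).map (algebraMap R A))
    {T : DerivedCategory (ModuleCat.{v} A)} (hT : IsPretiltingComplex T)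
    {X : DerivedCategory (ModuleCat.{v} B)} (hX : IsDerivedBaseChange f T X) :
    Module.Free R (End T) ↔ ∀ φ : X ⟶ X⟦(-1 : ℤ)⟧, φ = 0 := by
  obtain ⟨P, a, b, _, _, _, _, ⟨e⟩⟩ := hT.isPerfectComplex
  have hP (n : ℤ) : Module.Projective A (P.X n) :=
    (IsProjective.iff_projective (R := A) (P.X n)).2 inferInstance
  have : P.IsKProjective := isKProjective_of_projective P b
  let PB : CochainComplex (ModuleCat.{v} B) ℤ :=
    ((BaseChange.functor f).mapHomologicalComplex (ComplexShape.up ℤ)).obj P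
  -- Uniqueness of the derived base change allows `X` to be computed from the same `P`.
  obtain ⟨e'⟩ := IsDerivedBaseChange.nonempty_iso f
    (⟨P, b, inferInstance, inferInstance, ⟨e⟩, ⟨Iso.refl _⟩⟩ :
      IsDerivedBaseChange f T (DerivedCategory.Q.obj PB)) hX
  have (n : ℤ) : Projective (PB.X n) :=
    (IsProjective.iff_projective (R := B) (BaseChange.Tensor f (P.X n))).1 inferInstance
  have : PB.IsStrictlyLE b := by
    rw [isStrictlyLE_iff]
    exact fun i hi ↦ (BaseChange.functor f).map_isZero (P.isZero_of_isStrictlyLE b i hi)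
  have : PB.IsKProjective := isKProjective_of_projective _ b
  rw [DerivedCategory.forall_shiftedHom_eq_zero_iff e' (-2) (-1) 0 (by norm_num) (by norm_num),
    BaseChange.exact_cochain_iff f (IsLocalRing.maximalIdeal R) hf hI]
  have hfin (n : ℤ) : Module.Finite R (Cochain P P n) :=
    (Cochain.finite_and_projective P P a b n).1
  have hproj (n : ℤ) : Module.Projective R (Cochain P P n) :=
    (Cochain.finite_and_projective P P a b n).2
  have hexact (m n k : ℤ) (hmn : m + 1 = n) (hnk : n + 1 = k) (hn : n ≠ 0) :
      Function.Exact (δ_hom R P P m n) (δ_hom R P P n k) := by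
    intro z
    constructor
    · exact (DerivedCategory.forall_shiftedHom_eq_zero_iff e m n k hmn hnk).1
        (hT.hom_shift_eq_zero n hn) z
    · rintro ⟨y, rfl⟩
      exact δ_δ m n k y
  -- Cochains vanish in degrees above b - a, whence the bound b - a + 1.
  obtain ⟨r, hr⟩ := LinearMap.exists_retraction_ker_of_exact (R := R)
    (fun n ↦ δ_hom R P P n (n + 1))
    (fun n hn ↦ (hexact n (n + 1) (n + 1 + 1) rfl rfl (by omega)).linearMap_ker_eq.symm)
    (b - a + 1) (fun n hn ↦
      Cochain.subsingleton_of_isStrictlyGE_of_isStrictlyLE P P a b n (by omega))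
  let Z := LinearMap.ker (δ_hom R P P 0 1)
  replace hr : r ∘ₗ Z.subtype = LinearMap.id := hr
  have : Module.Projective R Z := Module.Projective.of_split _ r hr
  have : Module.Free R Z := Module.free_of_flat_of_isLocalRing
  let d : Cochain P P (-1) →ₗ[R] Z :=
    LinearMap.codRestrict Z (δ_hom R P P (-1) 0) fun y ↦ δ_δ _ _ _ y
  rw [Module.free_iff_of_exact (δ_hom R P P (-2) (-1)) d (DerivedCategory.endOfCocycle e) ?_ ?_
    (DerivedCategory.endOfCocycle_surjective e)]
  -- The criterion concerns 𝔪Z, the reduced complex 𝔪C⁰; the retraction `r` shows that they impose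
  -- the same condition on a coboundary.
  · refine forall_congr' fun x ↦ imp_congr ?_ Iff.rfl
    constructor
    · intro h
      have := Submodule.mem_map_of_mem (f := Z.subtype) h
      rw [Submodule.map_smul''] at this
      exact Submodule.smul_mono le_rfl le_top this
    · intro h
      have := Submodule.mem_map_of_mem (f := r) h
      rw [Submodule.map_smul''] at this
      have hx : r (δ (-1) 0 x) = d x := LinearMap.congr_fun hr (d x)
      rw [← hx]
      exact Submodule.smul_mono le_rfl le_top this
  · intro x
    rw [← hexact (-2) (-1) 0 (by norm_num) (by norm_num) (by norm_num) x]
    exact Subtype.ext_iff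
  · intro z
    rw [DerivedCategory.endOfCocycle_eq_zero_iff]
    exact exists_congr fun y ↦ (Subtype.ext_iff (a1 := d y) (a2 := z)).symm

end

end

theorem mainTheorem8 {R : Type*} {Λ : Type v} [CommRing R] [IsNoetherianRing R] [IsLocalRing R]
    [IsAdicComplete (IsLocalRing.maximalIdeal R) R]
    [Ring Λ] [Algebra R Λ] [Module.Finite R Λ] [Module.Free R Λ]
    [HasDerivedCategory.{w} (RightModuleCat Λ)]
    [HasDerivedCategory.{w'}
      (RightModuleCat (QuotientAlgebra Λ (IsLocalRing.maximalIdeal R)))]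
    (T : DerivedCategory (RightModuleCat Λ)) (hT : IsPretiltingComplex T)
    (Tbar : DerivedCategory
      (RightModuleCat (QuotientAlgebra Λ (IsLocalRing.maximalIdeal R))))
    (hTbar : IsDerivedReduction (IsLocalRing.maximalIdeal R) T Tbar) :
    Module.Free R (End T) ↔ ∀ φ : Tbar ⟶ Tbar⟦(-1 : ℤ)⟧, φ = 0 := by
  have : Module.Free R Λᵐᵒᵖ := Module.Free.of_equiv (MulOpposite.opLinearEquiv R)
  refine hT.free_end_iff _ ?_ ?_ hTbar
  · intro b
    obtain ⟨a, ha⟩ := Ideal.Quotient.mk_surjective b.unop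
    exact ⟨MulOpposite.op a, MulOpposite.unop_injective ha⟩
  · refine le_antisymm (fun a ha ↦ ?_) (Ideal.map_le_iff_le_comap.2 fun r hr ↦ ?_)
    · have h : a.unop ∈ (IsLocalRing.maximalIdeal R).map (algebraMap R Λ) :=
        Ideal.Quotient.eq_zero_iff_mem.1 (congr_arg MulOpposite.unop ha)
      rw [← MulOpposite.op_unop a]
      generalize a.unop = x at h
      induction h using Submodule.span_induction with
      | mem x hx =>
        obtain ⟨r, hr, rfl⟩ := hx
        exact Ideal.mem_map_of_mem (algebraMap R Λᵐᵒᵖ) hr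
      | zero => exact zero_mem _
      | add x y _ _ hx hy => exact add_mem hx hy
      -- Left multiplication in `Λ` is right multiplication in the opposite ring, where the extended
      -- ideal is still two-sided.
      | smul c x _ hx => exact Ideal.mul_mem_right (MulOpposite.op c) _ hx
    · exact congr_arg MulOpposite.op
        (Ideal.Quotient.eq_zero_iff_mem.2 (Ideal.mem_map_of_mem (algebraMap R Λ) hr))
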